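/- Let $\mathcal X=[0,1]^d$ with the Euclidean norm, $\mathcal Y=\{0,1\}$, and for $r\ge 0$, $\theta\in\mathcal X$ let $B_r(\theta)=\{x\in\mathcal X:\|x-\theta\|_2\le r\}$. Let $\mathbf P_{XY}$ be a probability distribution on $\mathcal X\times\mathcal Y$ and let $(r_n)$ be a sequence of nonnegative reals that does not depend on $\mathbf P_{XY}$. For each $n$ there are $n$ sensors. The triples $(\Theta_i,X_i,Y_i)$, $1\le i\le n$ (the sensors' centers and training examples), are independent; each center $\Theta_i$ is uniformly distributed on $\mathcal X$; and, given $\Theta_i=\theta$, the example $(X_i,Y_i)$ has the distribution $\mathbf P_{XY}$ conditioned on $X\in B_{r_n}(\theta)$ (for $\theta$ with $\mathbf P_X(B_{r_n}(\theta))=0$, where this is undefined, the conditional distribution of the example is arbitrary). A query with its unobserved label, $(X,Y)\sim\mathbf P_{XY}$, is independent of all the triples. Sensor $i$ responds to the query $X$ with $\delta_i(X)=Y_i$ if $X\in B_{r_n}(\Theta_i)$, and abstains otherwise. With $\Lambda(X)=\sum_{i=1}^n \mathbf 1_{\{X\in B_{r_n}(\Theta_i)\}}$ the number of responses, the fusion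 center takes a majority vote: $g_n(X)=1$ if $\frac1{\Lambda(X)}\sum_{i:\,X\in B_{r_n}(\Theta_i)}\delta_i(X)\ge\frac12$, and $g_n(X)=0$ otherwise (in particular if $\Lambda(X)=0$). Let $$L_n=\mathbf P\{g_n(X)\ne Y\mid (\Theta_i,X_i,Y_i)_{i=1}^n\},\qquad L^*=\inf_{g:\mathcal X\to\{0,1\}\text{ measurable}}\mathbf P\{g(X)\ne Y\}.$$ If $r_n\to0$ and $r_n^d\,n\to\infty$ as $n\to\infty$, then $\mathbf E\{L_n\}\to L^*$ for every distribution $\mathbf P_{XY}$ on $\mathcal X\times\mathcal Y$. -/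

import Mathlib

open MeasureTheory ProbabilityTheory Filter Topology

/-- The observation space `[0,1]^d`, with the Euclidean metric inherited from `ℝ^d`. -/
abbrev Cube (d : ℕ) : Type :=
  {x : EuclideanSpace ℝ (Fin d) // ∀ j, x j ∈ Set.Icc (0 : ℝ) 1}

/-- The uniform distribution on the cube: Lebesgue measure, whose total mass there is `1`. -/
noncomputable def cubeUniform (d : ℕ) : Measure (Cube d) :=
  Measure.comap Subtype.val volume

open Classical in
/-- The response of a sensor with center `θ` and training label `y` to the query `x`: the label if
`x` lies in the closed ball of radius `r` about `θ` (in the cube), abstention (`none`) otherwise. -/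
noncomputable def sensorResponse {d : ℕ} (r : ℝ) (θ : Cube d) (y : Fin 2) (x : Cube d) :
    Option (Fin 2) :=
  if x ∈ Metric.closedBall θ r then some y else none

/-- The contribution of a response to the vote count: the label, or nothing for an abstention. -/
def voteValue : Option (Fin 2) → ℝ
  | some y => ((y : ℕ) : ℝ)
  | none => 0

/-- Majority vote among the sensors that respond; `1` wins a tie. When no sensor responds the
quotient is `0 / 0 = 0`, and the decision is `0`. -/
noncomputable def majorityVote {n : ℕ} (δ : Fin n → Option (Fin 2)) : Fin 2 :=
  if (1 / 2 : ℝ) ≤ (∑ i, voteValue (δ i)) / (∑ i, if (δ i).isSome then (1 : ℝ) else 0)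
  then 1 else 0

/-- The decision of the network with radius `r`, centers `θ` and training labels `y` at `x`. -/
noncomputable def networkRule {d n : ℕ} (r : ℝ) (θ : Fin n → Cube d) (y : Fin n → Fin 2)
    (x : Cube d) : Fin 2 :=
  majorityVote fun i => sensorResponse r (θ i) (y i) x

/-- The random variables of the specialist model with `n` sensors, radius `r` and underlying
distribution `P` of (observation, label): sensor `i` has center `Θ i` and training example
`(X i, Y i)`, and `(Xq, Yq)` is the query with its unknown label. -/
structure IsSpecialistModel {d n : ℕ} {Ω : Type*} [MeasurableSpace Ω] (μ : Measure Ω)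
    (P : Measure (Cube d × Fin 2)) (r : ℝ) (Θ X : Fin n → Ω → Cube d) (Y : Fin n → Ω → Fin 2)
    (Xq : Ω → Cube d) (Yq : Ω → Fin 2) : Prop where
  measurable_center : ∀ i, Measurable (Θ i)
  measurable_obs : ∀ i, Measurable (X i)
  measurable_label : ∀ i, Measurable (Y i)
  measurable_queryObs : Measurable Xq
  measurable_queryLabel : Measurable Yq
  /-- The sensors are independent of each other. -/
  indep_sensors : iIndepFun (fun i ω => (Θ i ω, X i ω, Y i ω)) μ
  /-- The centers are uniformly distributed on the cube. -/
  center_uniform : ∀ i, μ.map (Θ i) = cubeUniform d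
  /-- Given `Θ i = θ`, the training example of sensor `i` is distributed as `P` conditioned on the
  observation lying in the ball about `θ`. Nothing is asked at centers whose ball has probability
  zero, where this conditional law is undefined. -/
  training_law : ∀ i, ∃ κ : Kernel (Cube d) (Cube d × Fin 2), IsMarkovKernel κ ∧
    (∀ θ, P {p | p.1 ∈ Metric.closedBall θ r} ≠ 0 →
      κ θ = P[|{p | p.1 ∈ Metric.closedBall θ r}]) ∧
    HasCondDistrib (fun ω => (X i ω, Y i ω)) (Θ i) κ μ
  /-- The query is drawn from `P`. -/
  query_law : μ.map (fun ω => (Xq ω, Yq ω)) = P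
  /-- The query is independent of the sensors. -/
  indep_query : IndepFun (fun ω i => (Θ i ω, X i ω, Y i ω)) (fun ω => (Xq ω, Yq ω)) μ

/-- `L_n`: the conditional probability that the network errs on the query, given the centers and
the training examples of all sensors. -/
noncomputable def conditionalError {d n : ℕ} {Ω : Type*} [MeasurableSpace Ω] (μ : Measure Ω)
    (r : ℝ) (Θ X : Fin n → Ω → Cube d) (Y : Fin n → Ω → Fin 2)
    (Xq : Ω → Cube d) (Yq : Ω → Fin 2) : Ω → ℝ :=
  μ⟦{ω | networkRule r (fun i => Θ i ω) (fun i => Y i ω) (Xq ω) ≠ Yq ω} |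
    MeasurableSpace.comap (fun ω (i : Fin n) => (Θ i ω, X i ω, Y i ω)) inferInstance⟧

/-- `L^*`: the infimum of the misclassification probability over all measurable classifiers. -/
noncomputable def bayesError {d : ℕ} (P : Measure (Cube d × Fin 2)) : ℝ :=
  ⨅ g : {g : Cube d → Fin 2 // Measurable g}, P.real {p | g.1 p.1 ≠ p.2}

/-! Write η for the posterior probability of the label 1 (`labelPosterior`), ρ for the law of the
observation, λ for the uniform law, and q for the λ-mass of the ball about a fixed query x. Let m(x)
be the average of η when a center θ is drawn from λ in the ball about x, then z from ρ in the ball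
about θ (`twoStepAverage`).

At x, the sum of the signed votes (±1, or 0 for an abstention) consists of independent terms. Its
mean is nq(2m(x) − 1) and its variance is at most nq, so Chebyshev bounds margin times probability
of deciding against it by 1/√(nq) (`margin_mul_measureReal_le`). Replacing m by η costs at most 2|η
− m|. Hence the excess over the Bayes error is at most 1/√(nq) + 2|η(x) − m(x)|
(`mixture_sub_min_le`).

The first term vanishes because q is at least a constant times r^d, uniformly in x. The second
vanishes in L¹(ρ) (`tendsto_lintegral_enorm_sub_twoStepAverage`): two-step averaging is bounded on
L¹(ρ) uniformly in r (`lintegral_twoStepLAverage_le`), which reduces η to a continuous function, and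
continuous functions on the compact cube are uniformly continuous. No regularity of ρ is needed,
because λ-balls of equal radius have comparable mass. -/

open scoped ENNReal

/-! ### Volumes of balls in the cube -/

theorem EuclideanSpace.volume_box {ι : Type*} [Fintype ι] (a b : ι → ℝ) :
    volume {x : EuclideanSpace ℝ ι | ∀ j, x j ∈ Set.Icc (a j) (b j)} =
      ∏ j, ENNReal.ofReal (b j - a j) := by
  have h : {x : EuclideanSpace ℝ ι | ∀ j, x j ∈ Set.Icc (a j) (b j)} =
      WithLp.ofLp ⁻¹' (Set.univ.pi fun j => Set.Icc (a j) (b j)) := by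
    ext x; simp only [Set.mem_ofPred_eq, Set.mem_preimage, Set.mem_univ_pi]
  rw [h, (PiLp.volume_preserving_ofLp ι).measure_preimage
    (MeasurableSet.univ_pi fun j => measurableSet_Icc).nullMeasurableSet, volume_pi_pi]
  simp [Real.volume_Icc]

theorem measurableSet_cube (d : ℕ) :
    MeasurableSet {x : EuclideanSpace ℝ (Fin d) | ∀ j, x j ∈ Set.Icc (0 : ℝ) 1} := by
  have h : {x : EuclideanSpace ℝ (Fin d) | ∀ j, x j ∈ Set.Icc (0 : ℝ) 1} =
      ⋂ j, (fun x : EuclideanSpace ℝ (Fin d) => x j) ⁻¹' Set.Icc 0 1 := by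
    ext x; simp
  rw [h]
  exact MeasurableSet.iInter fun j => (by fun_prop : Measurable _) measurableSet_Icc

theorem cubeUniform_apply (d : ℕ) (s : Set (Cube d)) (hs : MeasurableSet s) :
    cubeUniform d s = volume (Subtype.val '' s) :=
  Measure.comap_apply _ Subtype.val_injective
    (fun _ h => (MeasurableEmbedding.subtype_coe (measurableSet_cube d)).measurableSet_image' h)
    _ hs

instance (d : ℕ) : IsProbabilityMeasure (cubeUniform d) := by
  refine ⟨?_⟩
  rw [cubeUniform_apply d _ MeasurableSet.univ, Set.image_univ, Subtype.range_coe_subtype,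
    EuclideanSpace.volume_box]
  simp

instance (d : ℕ) : CompactSpace (Cube d) := by
  refine isCompact_iff_compactSpace.1 ?_
  have h : {x : EuclideanSpace ℝ (Fin d) | ∀ j, x j ∈ Set.Icc (0 : ℝ) 1} =
      (EuclideanSpace.equiv (Fin d) ℝ).toHomeomorph ⁻¹' (Set.univ.pi fun _ => Set.Icc 0 1) := by
    ext x; simp [Pi.le_def, forall_and]
  have := (EuclideanSpace.equiv (Fin d) ℝ).toHomeomorph.isCompact_preimage.2
    (isCompact_univ_pi fun _ : Fin d => isCompact_Icc (a := (0 : ℝ)) (b := 1))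
  rw [← h] at this
  exact this

/-- The factor `d + 1`, cruder than `√d`, is nonzero also for `d = 0`, so radii can be divided by
it. -/
theorem EuclideanSpace.norm_le_of_abs_le {d : ℕ} (v : EuclideanSpace ℝ (Fin d)) {s : ℝ}
    (hs : 0 ≤ s) (h : ∀ j, |v j| ≤ s) : ‖v‖ ≤ (d + 1) * s := by
  rw [EuclideanSpace.norm_eq]
  refine Real.sqrt_le_iff.2 ⟨by positivity, ?_⟩
  calc ∑ j, ‖v j‖ ^ 2 ≤ ∑ _j : Fin d, s ^ 2 :=
        Finset.sum_le_sum fun j _ => pow_le_pow_left₀ (norm_nonneg _) (h j) 2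
    _ = d * s ^ 2 := by simp
    _ ≤ ((d + 1) * s) ^ 2 := by
      have : (0 : ℝ) ≤ d := d.cast_nonneg
      nlinarith [mul_nonneg (mul_nonneg this this) (sq_nonneg s), mul_nonneg this (sq_nonneg s),
        sq_nonneg s]

theorem le_cubeUniform_closedBall {d : ℕ} (x : Cube d) {r : ℝ} (h0 : 0 ≤ r) (h1 : r ≤ 1 / 2) :
    ENNReal.ofReal ((r / (d + 1)) ^ d) ≤ cubeUniform d (Metric.closedBall x r) := by
  set s : ℝ := r / (d + 1) with hs
  have hd : (0 : ℝ) < d + 1 := by positivity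
  have hs0 : 0 ≤ s := by positivity
  have hs1 : s ≤ 1 / 2 := (div_le_self h0 (by linarith)).trans h1
  -- In each coordinate the interval of length `s` has `x j` as an endpoint and points to the
  -- farther face; `s ≤ 1 / 2` keeps it in `[0, 1]`, even for `x` on the boundary.
  set a : Fin d → ℝ := fun j => if x.1 j ≤ 1 / 2 then x.1 j else x.1 j - s with ha
  have hbox : volume {y : EuclideanSpace ℝ (Fin d) | ∀ j, y j ∈ Set.Icc (a j) (a j + s)} =
      ENNReal.ofReal (s ^ d) := by
    rw [EuclideanSpace.volume_box]
    simp [ENNReal.ofReal_pow hs0]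
  rw [cubeUniform_apply d _ measurableSet_closedBall, ← hbox]
  refine measure_mono fun y hy => ?_
  have hy' : ∀ j, 0 ≤ y j ∧ y j ≤ 1 ∧ |y j - x.1 j| ≤ s := by
    intro j
    obtain ⟨h2, h3⟩ := hy j
    obtain ⟨h4, h5⟩ := x.2 j
    simp only [ha] at h2 h3
    split_ifs at h2 h3 with h
    · exact ⟨by linarith, by linarith, abs_le.2 ⟨by linarith, by linarith⟩⟩
    · exact ⟨by linarith, by linarith, abs_le.2 ⟨by linarith, by linarith⟩⟩
  refine ⟨⟨y, fun j => ⟨(hy' j).1, (hy' j).2.1⟩⟩, ?_, rfl⟩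
  rw [Metric.mem_closedBall, Subtype.dist_eq, dist_eq_norm]
  refine (EuclideanSpace.norm_le_of_abs_le _ hs0 fun j => (hy' j).2.2).trans ?_
  rw [hs]; field_simp; exact le_rfl

theorem cubeUniform_closedBall_le {d : ℕ} (x : Cube d) {r : ℝ} (h0 : 0 ≤ r) :
    cubeUniform d (Metric.closedBall x r) ≤ ENNReal.ofReal ((2 * r) ^ d) := by
  have hbox : volume {y : EuclideanSpace ℝ (Fin d) | ∀ j, y j ∈ Set.Icc (x.1 j - r) (x.1 j + r)} =
      ENNReal.ofReal ((2 * r) ^ d) := by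
    rw [EuclideanSpace.volume_box, ENNReal.ofReal_pow (by positivity)]
    have : ∀ j, x.1 j + r - (x.1 j - r) = 2 * r := fun j => by ring
    simp [this]
  rw [cubeUniform_apply d _ measurableSet_closedBall, ← hbox]
  refine measure_mono ?_
  rintro _ ⟨y, hy, rfl⟩ j
  rw [Metric.mem_closedBall, Subtype.dist_eq, dist_eq_norm] at hy
  have h := (PiLp.norm_apply_le (y.1 - x.1) j).trans hy
  rw [PiLp.sub_apply, Real.norm_eq_abs, abs_le] at h
  exact ⟨by linarith, by linarith⟩

/-! ### Elementary estimates for averages -/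

theorem setLAverage_le_const_add {α : Type*} [MeasurableSpace α] {μ : Measure α} {s : Set α}
    (hs : MeasurableSet s) {f g : α → ℝ≥0∞} {a : ℝ≥0∞} (h : ∀ z ∈ s, f z ≤ a + g z) :
    ⨍⁻ z in s, f z ∂μ ≤ a + ⨍⁻ z in s, g z ∂μ := by
  rw [setLAverage_eq, setLAverage_eq]
  calc (∫⁻ z in s, f z ∂μ) / μ s ≤ (∫⁻ z in s, (a + g z) ∂μ) / μ s := by
        gcongr ?_ / _
        exact setLIntegral_mono' hs h
    _ = a * μ s / μ s + (∫⁻ z in s, g z ∂μ) / μ s := by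
        rw [lintegral_add_left measurable_const, ENNReal.add_div]
        simp
    -- `a * μ s / μ s` is `0` rather than `a` when `μ s` is `0` or `∞`.
    _ ≤ a + (∫⁻ z in s, g z ∂μ) / μ s := by
        gcongr
        exact ENNReal.div_le_of_le_mul le_rfl

theorem enorm_sub_average_le {α : Type*} [MeasurableSpace α] {μ : Measure α} [IsFiniteMeasure μ]
    (hμ : μ ≠ 0) {f : α → ℝ} (hf : Integrable f μ) (a : ℝ) :
    ‖a - ⨍ z, f z ∂μ‖ₑ ≤ ⨍⁻ z, ‖a - f z‖ₑ ∂μ := by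
  have : NeZero μ := ⟨hμ⟩
  have h : a - ⨍ z, f z ∂μ = ⨍ z, (a - f z) ∂μ := by
    rw [average, average,
      integral_sub (integrable_const _) (hf.smul_measure (by simp [hμ]))]
    have := average_const μ a
    rw [average] at this
    rw [this]
  rw [h]
  exact enorm_integral_le_lintegral_enorm _

theorem average_eq_toReal_laverage {α : Type*} [MeasurableSpace α] {μ : Measure α} {f : α → ℝ}
    (hf : Measurable f) (h0 : ∀ z, 0 ≤ f z) :
    ⨍ z, f z ∂μ = (⨍⁻ z, ENNReal.ofReal (f z) ∂μ).toReal :=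
  integral_eq_lintegral_of_nonneg_ae (ae_of_all _ h0) hf.aestronglyMeasurable

/-! ### Two-step averages and their L¹ convergence -/

section TwoStepAverage

/-- The average of `f z` when `θ` is drawn from `lam` in the ball of radius `r` about `x` and then
`z` is drawn from `rho` in the ball of radius `r` about `θ`. -/
noncomputable def twoStepLAverage {α : Type*} [PseudoMetricSpace α] [MeasurableSpace α]
    (lam rho : Measure α) (r : ℝ) (f : α → ℝ≥0∞) (x : α) : ℝ≥0∞ :=
  ⨍⁻ θ in Metric.closedBall x r, ⨍⁻ z in Metric.closedBall θ r, f z ∂rho ∂lam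

/-- The real-valued two-step average of `f`. -/
noncomputable def twoStepAverage {α : Type*} [PseudoMetricSpace α] [MeasurableSpace α]
    (lam rho : Measure α) (r : ℝ) (f : α → ℝ) (x : α) : ℝ :=
  ⨍ θ in Metric.closedBall x r, ⨍ z in Metric.closedBall θ r, f z ∂rho ∂lam

theorem twoStepLAverage_le_const_add {α : Type*} [PseudoMetricSpace α] [MeasurableSpace α]
    [OpensMeasurableSpace α] {lam rho : Measure α} {r : ℝ} {f g : α → ℝ≥0∞} {x : α} {a : ℝ≥0∞}
    (h : ∀ z, dist z x ≤ 2 * r → f z ≤ a + g z) :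
    twoStepLAverage lam rho r f x ≤ a + twoStepLAverage lam rho r g x :=
  setLAverage_le_const_add measurableSet_closedBall fun θ hθ =>
    setLAverage_le_const_add measurableSet_closedBall fun z hz => h z <| by
      have := dist_triangle z θ x
      rw [Metric.mem_closedBall] at hθ hz
      linarith

theorem setLIntegral_closedBall_eq {α : Type*} [PseudoMetricSpace α] [MeasurableSpace α]
    [OpensMeasurableSpace α] (rho : Measure α) (r : ℝ) (f : α → ℝ≥0∞) (x : α) :
    ∫⁻ z in Metric.closedBall x r, f z ∂rho =
      ∫⁻ z, {p : α × α | dist p.2 p.1 ≤ r}.indicator (fun p => f p.2) (x, z) ∂rho := by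
  rw [← lintegral_indicator measurableSet_closedBall]
  rfl

variable {α : Type*} [PseudoMetricSpace α] [SecondCountableTopology α] [MeasurableSpace α]
  [BorelSpace α]

theorem measurableSet_dist_le (r : ℝ) : MeasurableSet {p : α × α | dist p.2 p.1 ≤ r} :=
  (isClosed_le (by fun_prop) (by fun_prop)).measurableSet

theorem measurable_measure_closedBall (rho : Measure α) [SFinite rho] (r : ℝ) :
    Measurable fun x => rho (Metric.closedBall x r) :=
  measurable_measure_prodMk_left (measurableSet_dist_le r)

theorem measurable_setLIntegral_closedBall (rho : Measure α) [SFinite rho] (r : ℝ)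
    {f : α → ℝ≥0∞} (hf : Measurable f) :
    Measurable fun x => ∫⁻ z in Metric.closedBall x r, f z ∂rho := by
  simp only [setLIntegral_closedBall_eq]
  exact ((hf.comp measurable_snd).indicator (measurableSet_dist_le r)).lintegral_prod_right'

theorem measurable_setLAverage_closedBall (rho : Measure α) [SFinite rho] (r : ℝ)
    {f : α → ℝ≥0∞} (hf : Measurable f) :
    Measurable fun x => ⨍⁻ z in Metric.closedBall x r, f z ∂rho := by
  simp only [setLAverage_eq]
  exact (measurable_setLIntegral_closedBall rho r hf).div (measurable_measure_closedBall rho r)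

/-- Tonelli, together with the symmetry of the relation `dist z x ≤ r`. -/
theorem lintegral_setLIntegral_closedBall (lam rho : Measure α) [SFinite lam] [SFinite rho]
    (r : ℝ) {f : α → ℝ≥0∞} (hf : Measurable f) :
    ∫⁻ x, ∫⁻ z in Metric.closedBall x r, f z ∂rho ∂lam =
      ∫⁻ z, f z * lam (Metric.closedBall z r) ∂rho := by
  simp only [setLIntegral_closedBall_eq]
  rw [lintegral_lintegral_swap
    (f := fun x z => {p : α × α | dist p.2 p.1 ≤ r}.indicator (fun p => f p.2) (x, z))
    ((hf.comp measurable_snd).indicator (measurableSet_dist_le r)).aemeasurable]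
  refine lintegral_congr fun z => ?_
  have : ∀ x, {p : α × α | dist p.2 p.1 ≤ r}.indicator (fun p => f p.2) (x, z) =
      (Metric.closedBall z r).indicator (fun _ => f z) x := fun x => by
    have hmem : (x, z) ∈ {p : α × α | dist p.2 p.1 ≤ r} ↔ x ∈ Metric.closedBall z r := by
      rw [Metric.mem_closedBall, dist_comm]; rfl
    by_cases hxz : x ∈ Metric.closedBall z r
    · rw [Set.indicator_of_mem hxz, Set.indicator_of_mem (hmem.2 hxz)]
    · rw [Set.indicator_of_notMem hxz, Set.indicator_of_notMem (mt hmem.1 hxz)]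
  simp only [this, lintegral_indicator_const measurableSet_closedBall]

/-- After the outer denominator is bounded below by `c`, a first exchange of integrals produces the
factor `rho (closedBall θ r)`, which cancels the inner denominator whatever `rho` is. A second
exchange produces `lam (closedBall z r)`, at most `C * c`. -/
theorem lintegral_twoStepLAverage_le {lam rho : Measure α} [IsFiniteMeasure lam]
    [IsFiniteMeasure rho] {r : ℝ} {c C : ℝ≥0∞} (hc : c ≠ 0) (hct : c ≠ ∞)
    (hlow : ∀ x, c ≤ lam (Metric.closedBall x r))
    (hup : ∀ x, lam (Metric.closedBall x r) ≤ C * c) {f : α → ℝ≥0∞} (hf : Measurable f) :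
    ∫⁻ x, twoStepLAverage lam rho r f x ∂rho ≤ C * ∫⁻ z, f z ∂rho := by
  set u : α → ℝ≥0∞ := fun θ => ⨍⁻ z in Metric.closedBall θ r, f z ∂rho with hu
  have hum : Measurable u := measurable_setLAverage_closedBall rho r hf
  calc ∫⁻ x, twoStepLAverage lam rho r f x ∂rho
      ≤ ∫⁻ x, c⁻¹ * ∫⁻ θ in Metric.closedBall x r, u θ ∂lam ∂rho := by
        refine lintegral_mono fun x => ?_
        simp only [twoStepLAverage]
        rw [setLAverage_eq, ENNReal.div_eq_inv_mul]
        gcongr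
        exact hlow x
    _ = c⁻¹ * ∫⁻ θ, u θ * rho (Metric.closedBall θ r) ∂lam := by
        rw [lintegral_const_mul _ (measurable_setLIntegral_closedBall lam r hum),
          lintegral_setLIntegral_closedBall rho lam r hum]
    _ ≤ c⁻¹ * ∫⁻ θ, ∫⁻ z in Metric.closedBall θ r, f z ∂rho ∂lam := by
        gcongr with θ
        simp only [hu]
        rw [setLAverage_eq]
        exact ENNReal.mul_le_of_le_div le_rfl
    _ = c⁻¹ * ∫⁻ z, f z * lam (Metric.closedBall z r) ∂rho := by
        rw [lintegral_setLIntegral_closedBall lam rho r hf]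
    _ ≤ c⁻¹ * ∫⁻ z, f z * (C * c) ∂rho := by
        gcongr with z
        exact hup z
    _ = C * ∫⁻ z, f z ∂rho := by
        rw [lintegral_mul_const _ hf]
        calc c⁻¹ * ((∫⁻ z, f z ∂rho) * (C * c)) = (c⁻¹ * c) * (C * ∫⁻ z, f z ∂rho) := by ring
          _ = _ := by rw [ENNReal.inv_mul_cancel hc hct, one_mul]

/-- Centers with a null ball do not matter: for the set `s` of these, exchanging integrals turns the
`rho`-integral of `lam (s ∩ closedBall x r)` into the integral of `rho (closedBall θ r)` over `s`,
which is zero. -/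
theorem ae_ae_measure_closedBall_ne_zero (lam rho : Measure α) [IsFiniteMeasure lam]
    [IsFiniteMeasure rho] (r : ℝ) :
    ∀ᵐ x ∂rho, ∀ᵐ θ ∂lam.restrict (Metric.closedBall x r), rho (Metric.closedBall θ r) ≠ 0 := by
  set s : Set α := {θ | rho (Metric.closedBall θ r) = 0} with hs
  have hsm : MeasurableSet s := measurable_measure_closedBall rho r (measurableSet_singleton 0)
  have hm : Measurable (s.indicator (1 : α → ℝ≥0∞)) := measurable_one.indicator hsm
  have h : ∫⁻ x, ∫⁻ θ in Metric.closedBall x r, s.indicator 1 θ ∂lam ∂rho = 0 := by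
    rw [lintegral_setLIntegral_closedBall rho lam r hm, ← lintegral_zero]
    refine lintegral_congr fun θ => ?_
    by_cases hθ : θ ∈ s
    · rw [show rho (Metric.closedBall θ r) = 0 from hθ, mul_zero]
    · simp [hθ]
  rw [lintegral_eq_zero_iff (measurable_setLIntegral_closedBall lam r hm)] at h
  filter_upwards [h] with x hx
  have hx' := (lintegral_eq_zero_iff hm).1 hx
  filter_upwards [hx'] with θ hθ h0
  have : θ ∈ s := h0
  simp [this] at hθ

theorem measurable_setAverage_closedBall (rho : Measure α) [SFinite rho] (r : ℝ) {f : α → ℝ}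
    (hf : Measurable f) (h0 : ∀ z, 0 ≤ f z) :
    Measurable fun x => ⨍ z in Metric.closedBall x r, f z ∂rho := by
  simp only [average_eq_toReal_laverage hf h0]
  exact (measurable_setLAverage_closedBall rho r hf.ennreal_ofReal).ennreal_toReal

/-- The triangle inequality for averages, applied twice. Null balls must be excluded, since there
the average is `0` by convention and does not reproduce the constant `a`. -/
theorem enorm_sub_twoStepAverage_le {lam rho : Measure α} [IsFiniteMeasure lam]
    [IsFiniteMeasure rho] {r : ℝ} {f : α → ℝ} (hf : Measurable f) (h0 : ∀ z, 0 ≤ f z)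
    (h1 : ∀ z, f z ≤ 1) {x : α} (hx : lam (Metric.closedBall x r) ≠ 0)
    (hae : ∀ᵐ θ ∂lam.restrict (Metric.closedBall x r), rho (Metric.closedBall θ r) ≠ 0) (a : ℝ) :
    ‖a - twoStepAverage lam rho r f x‖ₑ ≤ twoStepLAverage lam rho r (fun z => ‖a - f z‖ₑ) x := by
  set u : α → ℝ := fun θ => ⨍ z in Metric.closedBall θ r, f z ∂rho with hu
  have hu' : u = fun θ => (⨍⁻ z in Metric.closedBall θ r, ENNReal.ofReal (f z) ∂rho).toReal :=
    funext fun θ => average_eq_toReal_laverage hf h0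
  have hum : Measurable u := measurable_setAverage_closedBall rho r hf h0
  have hub : ∀ θ, ‖u θ‖ ≤ 1 := fun θ => by
    rw [hu', Real.norm_of_nonneg ENNReal.toReal_nonneg]
    refine ENNReal.toReal_le_of_le_ofReal zero_le_one ?_
    refine (setLAverage_le_const_add (a := 1) (g := 0) measurableSet_closedBall fun z _ => ?_).trans
      ?_
    · simpa using h1 z
    · simp
  have hui : Integrable u (lam.restrict (Metric.closedBall x r)) :=
    Integrable.of_bound hum.aestronglyMeasurable 1 (ae_of_all _ hub)
  refine (enorm_sub_average_le (by simpa using hx) hui a).trans ?_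
  refine lintegral_mono_ae (Measure.ae_smul_measure ?_ _)
  filter_upwards [hae] with θ hθ
  exact enorm_sub_average_le (by simpa using hθ) (Integrable.of_bound hf.aestronglyMeasurable 1
    (ae_of_all _ fun z => by rw [Real.norm_of_nonneg (h0 z)]; exact h1 z)) a

theorem tendsto_lintegral_enorm_sub_twoStepAverage [CompactSpace α]
    {lam rho : Measure α} [IsFiniteMeasure lam] [IsProbabilityMeasure rho] {r : ℕ → ℝ}
    (hr : Tendsto r atTop (𝓝 0)) {C : ℝ≥0∞} (hC : C ≠ ∞)
    (hball : ∀ᶠ n in atTop, ∃ c : ℝ≥0∞, c ≠ 0 ∧ c ≠ ∞ ∧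
      (∀ x, c ≤ lam (Metric.closedBall x (r n))) ∧ ∀ x, lam (Metric.closedBall x (r n)) ≤ C * c)
    {f : α → ℝ} (hf : Measurable f) (h0 : ∀ z, 0 ≤ f z) (h1 : ∀ z, f z ≤ 1) :
    Tendsto (fun n => ∫⁻ x, ‖f x - twoStepAverage lam rho (r n) f x‖ₑ ∂rho) atTop (𝓝 0) := by
  refine ENNReal.tendsto_nhds_zero.2 fun ε hε => ?_
  have hC2 : 2 + C ≠ ∞ := by simp [hC]
  -- Three errors add up to `(2 + C) * δ`: `δ` for approximating `f` by a continuous `h` in L¹, `δ`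
  -- for the oscillation of `h` over distance `2 * r n`, and `C * δ` for the two-step average of `|f
  -- - h|`.
  set δ : ℝ≥0∞ := ε / (2 + C) with hδ
  have hδ0 : δ ≠ 0 := (ENNReal.div_pos hε.ne' hC2).ne'
  have hfi : Integrable f rho := Integrable.of_bound hf.aestronglyMeasurable 1
    (ae_of_all _ fun z => by rw [Real.norm_of_nonneg (h0 z)]; exact h1 z)
  obtain ⟨h, hh, -⟩ := hfi.exists_boundedContinuous_lintegral_sub_le hδ0
  obtain ⟨η, hη, hmod⟩ := EMetric.uniformContinuous_iff.1
    (CompactSpace.uniformContinuous_of_continuous h.continuous) δ hδ0.bot_lt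
  have hr2 : Tendsto (fun n => ENNReal.ofReal (2 * r n)) atTop (𝓝 0) := by
    simpa using ENNReal.tendsto_ofReal (hr.const_mul 2)
  filter_upwards [hball, hr2.eventually_lt_const hη] with n ⟨c, hc, hct, hlow, hup⟩ hn
  have hmeas : Measurable fun z => ‖f z - h z‖ₑ := by
    have := h.continuous.measurable
    fun_prop
  calc ∫⁻ x, ‖f x - twoStepAverage lam rho (r n) f x‖ₑ ∂rho
      ≤ ∫⁻ x, (‖f x - h x‖ₑ + (δ + twoStepLAverage lam rho (r n) (fun z => ‖f z - h z‖ₑ) x))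
          ∂rho := by
        refine lintegral_mono_ae ?_
        filter_upwards [ae_ae_measure_closedBall_ne_zero lam rho (r n)] with x hx
        refine (enorm_sub_twoStepAverage_le hf h0 h1
          ((hc.bot_lt.trans_le (hlow x)).ne') hx (f x)).trans ?_
        rw [← add_assoc]
        refine twoStepLAverage_le_const_add fun z hz => ?_
        have hxz : ‖h x - h z‖ₑ ≤ δ := by
          rw [← edist_eq_enorm_sub, edist_comm]
          refine (hmod (lt_of_le_of_lt ?_ hn)).le
          rw [edist_dist]
          exact ENNReal.ofReal_le_ofReal hz
        calc ‖f x - f z‖ₑ = ‖(f x - h x) + (h x - h z) + (h z - f z)‖ₑ := by congr 1; ring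
          _ ≤ ‖f x - h x‖ₑ + ‖h x - h z‖ₑ + ‖h z - f z‖ₑ :=
            (enorm_add_le _ _).trans (add_le_add_left (enorm_add_le _ _) _)
          _ ≤ _ := by
            rw [enorm_sub_rev (h z)]
            gcongr
    _ ≤ δ + (δ + C * δ) := by
        rw [lintegral_add_left hmeas, lintegral_add_left measurable_const]
        gcongr
        · simp
        · exact (lintegral_twoStepLAverage_le hc hct hlow hup hmeas).trans (by gcongr)
    _ = (2 + C) * δ := by ring
    _ ≤ ε := ENNReal.mul_div_le

end TwoStepAverage

/-! ### A Chebyshev bound, and the majority vote as the sign of a sum -/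

/-- For `t ≤ 1 / √N` it suffices that a probability is at most 1. For larger `t`, Chebyshev gives `t
* N / (N * t) ^ 2 = 1 / (N * t)`, which is below `1 / √N`. The product form needs no lower bound on
the margin `t`. -/
theorem mul_measureReal_nonpos_le {Ω : Type*} [MeasurableSpace Ω] {μ : Measure Ω}
    [IsProbabilityMeasure μ] {S : Ω → ℝ} (hS : MemLp S 2 μ) {N t : ℝ} (hN : 0 < N)
    (hmean : ∫ ω, S ω ∂μ = N * t) (hvar : Var[S; μ] ≤ N) :
    t * μ.real {ω | S ω ≤ 0} ≤ 1 / √N := by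
  have hp0 : 0 ≤ μ.real {ω | S ω ≤ 0} := measureReal_nonneg
  have hp1 : μ.real {ω | S ω ≤ 0} ≤ 1 := measureReal_le_one
  have hsq : 0 < √N := Real.sqrt_pos.2 hN
  rcases le_or_gt t (1 / √N) with h | h
  · have : 0 ≤ 1 / √N := by positivity
    nlinarith
  have ht : 0 < t := lt_trans (by positivity) h
  have hc : 0 < N * t := mul_pos hN ht
  have hcheb : μ.real {ω | S ω ≤ 0} ≤ Var[S; μ] / (N * t) ^ 2 := by
    refine ENNReal.toReal_le_of_le_ofReal (div_nonneg (variance_nonneg _ _) (sq_nonneg _)) ?_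
    refine (measure_mono fun ω hω => ?_).trans (meas_ge_le_variance_div_sq hS hc)
    have hω' : S ω ≤ 0 := hω
    change N * t ≤ |S ω - ∫ ω, S ω ∂μ|
    rw [hmean, abs_sub_comm]
    exact le_trans (by linarith) (le_abs_self _)
  calc t * μ.real {ω | S ω ≤ 0} ≤ t * (N / (N * t) ^ 2) := by
        gcongr
        exact hcheb.trans (by gcongr)
    _ = 1 / (N * t) := by field_simp
    _ ≤ 1 / √N := by
        refine one_div_le_one_div_of_le hsq ?_
        rw [div_lt_iff₀ hsq] at h
        have := Real.mul_self_sqrt hN.le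
        nlinarith

/-- The signed contribution of a response to the vote: `1`, `-1`, or `0` for an abstention. -/
def voteSign : Option (Fin 2) → ℝ
  | some y => 2 * ((y : ℕ) : ℝ) - 1
  | none => 0

theorem voteSign_eq (o : Option (Fin 2)) :
    voteSign o = 2 * voteValue o - if o.isSome then (1 : ℝ) else 0 := by
  cases o <;> simp [voteSign, voteValue]

theorem voteValue_le (o : Option (Fin 2)) : voteValue o ≤ if o.isSome then (1 : ℝ) else 0 := by
  rcases o with _ | y
  · simp [voteValue]
  · fin_cases y <;> simp [voteValue]

theorem majorityVote_eq_one_iff {n : ℕ} (δ : Fin n → Option (Fin 2)) :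
    majorityVote δ = 1 ↔
      (1 / 2 : ℝ) ≤ (∑ i, voteValue (δ i)) / (∑ i, if (δ i).isSome then (1 : ℝ) else 0) := by
  unfold majorityVote
  split_ifs with h
  · exact iff_of_true rfl h
  · exact iff_of_false zero_ne_one h

theorem sum_voteSign_nonneg {n : ℕ} {δ : Fin n → Option (Fin 2)} (h : majorityVote δ = 1) :
    0 ≤ ∑ i, voteSign (δ i) := by
  rw [majorityVote_eq_one_iff] at h
  have h0 : 0 ≤ ∑ i, if (δ i).isSome then (1 : ℝ) else 0 :=
    Finset.sum_nonneg fun i _ => by split_ifs <;> norm_num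
  simp only [voteSign_eq, Finset.sum_sub_distrib, ← Finset.mul_sum]
  rcases h0.eq_or_lt with h1 | h1
  -- Without responses the quotient `0 / 0 = 0` is below `1 / 2`, so the decision cannot be `1`.
  · rw [← h1] at h; norm_num at h
  · rw [le_div_iff₀ h1] at h; linarith

theorem sum_voteSign_nonpos {n : ℕ} {δ : Fin n → Option (Fin 2)} (h : majorityVote δ ≠ 1) :
    ∑ i, voteSign (δ i) ≤ 0 := by
  rw [Ne, majorityVote_eq_one_iff, not_le] at h
  have h0 : 0 ≤ ∑ i, if (δ i).isSome then (1 : ℝ) else 0 :=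
    Finset.sum_nonneg fun i _ => by split_ifs <;> norm_num
  have h2 : ∑ i, voteValue (δ i) ≤ ∑ i, if (δ i).isSome then (1 : ℝ) else 0 :=
    Finset.sum_le_sum fun i _ => voteValue_le (δ i)
  simp only [voteSign_eq, Finset.sum_sub_distrib, ← Finset.mul_sum]
  rcases h0.eq_or_lt with h1 | h1
  · linarith
  · rw [div_lt_iff₀ h1] at h; linarith

/-- By symmetry of the distance, the vote at a fixed query depends on whether the center lies in the
ball about the query, so its mean reduces to probabilities of events for center and label. -/
theorem voteSign_sensorResponse {d : ℕ} (r : ℝ) (θ : Cube d) (y : Fin 2) (x : Cube d) :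
    voteSign (sensorResponse r θ y x) =
      2 * (Metric.closedBall x r ×ˢ {(1 : Fin 2)}).indicator 1 (θ, y) -
        (Metric.closedBall x r).indicator 1 θ := by
  classical
  simp only [sensorResponse, Set.indicator_apply, Set.mem_prod, Metric.mem_closedBall,
    dist_comm x θ, Pi.one_apply]
  split_ifs with h1 h2 h2
  · simp_all [voteSign]
  · have : y = 0 := by
      have : y ≠ 1 := fun h => h2 ⟨h1, h⟩
      omega
    simp [voteSign, this]
  · exact absurd h2.1 h1
  · simp [voteSign]

theorem voteSign_sensorResponse_sq {d : ℕ} (r : ℝ) (θ : Cube d) (y : Fin 2) (x : Cube d) :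
    voteSign (sensorResponse r θ y x) ^ 2 = (Metric.closedBall x r).indicator 1 θ := by
  classical
  simp only [sensorResponse, Set.indicator_apply, Metric.mem_closedBall, dist_comm x θ,
    Pi.one_apply]
  split_ifs with h1
  · fin_cases y <;> norm_num [voteSign]
  · simp [voteSign]

theorem measurable_voteSign_sensorResponse {d : ℕ} (r : ℝ) (x : Cube d) :
    Measurable fun p : Cube d × Fin 2 => voteSign (sensorResponse r p.1 p.2 x) := by
  simp only [voteSign_sensorResponse]
  refine Measurable.sub (Measurable.const_mul ?_ 2) ?_
  · exact measurable_one.indicator (measurableSet_closedBall.prod (measurableSet_singleton 1))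
  · exact (measurable_one.indicator measurableSet_closedBall).comp measurable_fst

/-! ### The posterior and its local averages -/

/-- The conditional probability of the label `1` given the observation. -/
noncomputable def labelPosterior {d : ℕ} (P : Measure (Cube d × Fin 2)) [IsFiniteMeasure P]
    (x : Cube d) : ℝ :=
  (P.condKernel x).real {1}

section Posterior

variable {d : ℕ} (P : Measure (Cube d × Fin 2)) [IsFiniteMeasure P]

theorem measurable_labelPosterior : Measurable (labelPosterior P) :=
  (P.condKernel.measurable_coe (measurableSet_singleton 1)).ennreal_toReal

theorem labelPosterior_nonneg (x : Cube d) : 0 ≤ labelPosterior P x := measureReal_nonneg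

theorem labelPosterior_le_one (x : Cube d) : labelPosterior P x ≤ 1 := measureReal_le_one

theorem ofReal_labelPosterior (x : Cube d) :
    ENNReal.ofReal (labelPosterior P x) = P.condKernel x {1} := ofReal_measureReal

theorem cond_label_one {θ : Cube d} {r : ℝ} (h : P.fst (Metric.closedBall θ r) ≠ 0) :
    P[|{p | p.1 ∈ Metric.closedBall θ r}] (Set.univ ×ˢ {1}) =
      ENNReal.ofReal (⨍ z in Metric.closedBall θ r, labelPosterior P z ∂P.fst) := by
  have hA : MeasurableSet {p : Cube d × Fin 2 | p.1 ∈ Metric.closedBall θ r} :=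
    measurable_fst measurableSet_closedBall
  have hset : {p : Cube d × Fin 2 | p.1 ∈ Metric.closedBall θ r} ∩ (Set.univ ×ˢ {1}) =
      Metric.closedBall θ r ×ˢ {1} := by
    ext p; simp
  have hjoint : P (Metric.closedBall θ r ×ˢ {1}) =
      ∫⁻ z in Metric.closedBall θ r, P.condKernel z {1} ∂P.fst := by
    conv_lhs => rw [← P.disintegrate P.condKernel]
    exact Measure.compProd_apply_prod measurableSet_closedBall (measurableSet_singleton 1)
  have hfst : P {p | p.1 ∈ Metric.closedBall θ r} = P.fst (Metric.closedBall θ r) :=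
    (Measure.fst_apply measurableSet_closedBall).symm
  rw [cond_apply hA, hset, hjoint, hfst,
    average_eq_toReal_laverage (measurable_labelPosterior P) (labelPosterior_nonneg P)]
  simp only [ofReal_labelPosterior]
  rw [setLAverage_eq, ENNReal.ofReal_toReal, ENNReal.div_eq_inv_mul]
  refine ENNReal.div_ne_top ?_ h
  rw [← hjoint]
  exact measure_ne_top _ _

end Posterior

/-! ### Mean and variance of the vote at a fixed query -/

namespace IsSpecialistModel

variable {d n : ℕ} {Ω : Type*} [MeasurableSpace Ω] {μ : Measure Ω}
  {P : Measure (Cube d × Fin 2)} {r : ℝ} {Θ X : Fin n → Ω → Cube d}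
  {Y : Fin n → Ω → Fin 2} {Xq : Ω → Cube d} {Yq : Ω → Fin 2}

theorem measureReal_center_mem (h : IsSpecialistModel μ P r Θ X Y Xq Yq) (i : Fin n)
    (x : Cube d) :
    μ.real (Θ i ⁻¹' Metric.closedBall x r) = (cubeUniform d).real (Metric.closedBall x r) := by
  rw [← h.center_uniform i, map_measureReal_apply (h.measurable_center i) measurableSet_closedBall]

/-- Integrating the training kernel over the center gives the inner average of the posterior at
almost every center; `hae` makes the centers where the kernel is arbitrary negligible. The factor in
front undoes the normalization of the outer average. -/
theorem measureReal_center_mem_label_one [IsProbabilityMeasure P]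
    (h : IsSpecialistModel μ P r Θ X Y Xq Yq) (i : Fin n)
    {x : Cube d} (hx : cubeUniform d (Metric.closedBall x r) ≠ 0)
    (hae : ∀ᵐ θ ∂(cubeUniform d).restrict (Metric.closedBall x r),
      P.fst (Metric.closedBall θ r) ≠ 0) :
    μ.real ((fun ω => (Θ i ω, Y i ω)) ⁻¹' (Metric.closedBall x r ×ˢ {1})) =
      (cubeUniform d).real (Metric.closedBall x r) *
        twoStepAverage (cubeUniform d) P.fst r (labelPosterior P) x := by
  obtain ⟨κ, hκ, hκP, hlaw⟩ := h.training_law i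
  have hmap := hlaw.map_eq
  have hE : MeasurableSet (Metric.closedBall x r ×ˢ (Set.univ ×ˢ {(1 : Fin 2)}) :
      Set (Cube d × (Cube d × Fin 2))) :=
    measurableSet_closedBall.prod (MeasurableSet.univ.prod (measurableSet_singleton 1))
  have hpre : (fun ω => (Θ i ω, Y i ω)) ⁻¹' (Metric.closedBall x r ×ˢ {1}) =
      (fun ω => (Θ i ω, (X i ω, Y i ω))) ⁻¹' (Metric.closedBall x r ×ˢ (Set.univ ×ˢ {1})) := by
    ext ω; simp
  have hμ : μ ((fun ω => (Θ i ω, Y i ω)) ⁻¹' (Metric.closedBall x r ×ˢ {1})) =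
      ∫⁻ θ in Metric.closedBall x r,
        ENNReal.ofReal (⨍ z in Metric.closedBall θ r, labelPosterior P z ∂P.fst) ∂cubeUniform d := by
    rw [hpre, ← Measure.map_apply ((h.measurable_center i).prodMk
      ((h.measurable_obs i).prodMk (h.measurable_label i))) hE, hmap, h.center_uniform i,
      Measure.compProd_apply_prod measurableSet_closedBall
        (MeasurableSet.univ.prod (measurableSet_singleton 1))]
    refine lintegral_congr_ae ?_
    filter_upwards [hae] with θ hθ
    rw [hκP θ (by rwa [Measure.fst_apply measurableSet_closedBall] at hθ), cond_label_one P hθ]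
  rw [measureReal_def, hμ, ← integral_eq_lintegral_of_nonneg_ae, twoStepAverage, setAverage_eq,
    smul_eq_mul, ← mul_assoc, mul_inv_cancel₀, one_mul]
  · rw [measureReal_def, Ne, ENNReal.toReal_eq_zero_iff]
    simp [hx]
  · refine ae_of_all _ fun θ => ?_
    beta_reduce
    rw [average_eq_toReal_laverage (measurable_labelPosterior P) (labelPosterior_nonneg P)]
    exact ENNReal.toReal_nonneg
  · exact (measurable_setAverage_closedBall P.fst r (measurable_labelPosterior P)
      (labelPosterior_nonneg P)).aestronglyMeasurable

theorem measurable_voteSign (h : IsSpecialistModel μ P r Θ X Y Xq Yq) (i : Fin n) (x : Cube d) :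
    Measurable fun ω => voteSign (sensorResponse r (Θ i ω) (Y i ω) x) := by
  have hp : Measurable fun ω => (Θ i ω, Y i ω) :=
    (h.measurable_center i).prodMk (h.measurable_label i)
  have hcomp := Measurable.comp (measurable_voteSign_sensorResponse r x) hp
  exact hcomp

variable [IsProbabilityMeasure μ]

theorem memLp_voteSign (h : IsSpecialistModel μ P r Θ X Y Xq Yq) (i : Fin n) (x : Cube d) :
    MemLp (fun ω => voteSign (sensorResponse r (Θ i ω) (Y i ω) x)) 2 μ := by
  refine MemLp.of_bound (h.measurable_voteSign i x).aestronglyMeasurable 1 (ae_of_all _ fun ω => ?_)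
  rw [Real.norm_eq_abs, ← sq_le_one_iff_abs_le_one, voteSign_sensorResponse_sq]
  exact Set.indicator_le_self' (fun _ _ => zero_le_one) _

/-- The variance is at most the second moment, and a squared signed vote is the indicator of a
response. -/
theorem variance_voteSign_le (h : IsSpecialistModel μ P r Θ X Y Xq Yq) (i : Fin n)
    (x : Cube d) :
    Var[fun ω => voteSign (sensorResponse r (Θ i ω) (Y i ω) x); μ] ≤
      (cubeUniform d).real (Metric.closedBall x r) := by
  refine (variance_le_expectation_sq (h.measurable_voteSign i x).aestronglyMeasurable).trans
    (le_of_eq ?_)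
  rw [← h.measureReal_center_mem i x, ← integral_indicator_one
    (h.measurable_center i measurableSet_closedBall)]
  refine integral_congr_ae (ae_of_all _ fun ω => ?_)
  exact voteSign_sensorResponse_sq r (Θ i ω) (Y i ω) x

theorem integral_voteSign [IsProbabilityMeasure P]
    (h : IsSpecialistModel μ P r Θ X Y Xq Yq) (i : Fin n) {x : Cube d} (hx : cubeUniform d (Metric.closedBall x r) ≠ 0)
    (hae : ∀ᵐ θ ∂(cubeUniform d).restrict (Metric.closedBall x r),
      P.fst (Metric.closedBall θ r) ≠ 0) :
    ∫ ω, voteSign (sensorResponse r (Θ i ω) (Y i ω) x) ∂μ =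
      (cubeUniform d).real (Metric.closedBall x r) *
        (2 * twoStepAverage (cubeUniform d) P.fst r (labelPosterior P) x - 1) := by
  set A := (fun ω => (Θ i ω, Y i ω)) ⁻¹' (Metric.closedBall x r ×ˢ {(1 : Fin 2)}) with hA
  set B := Θ i ⁻¹' Metric.closedBall x r with hB
  have hAm : MeasurableSet A := ((h.measurable_center i).prodMk (h.measurable_label i))
    (measurableSet_closedBall.prod (measurableSet_singleton 1))
  have hBm : MeasurableSet B := h.measurable_center i measurableSet_closedBall
  have heq : ∀ ω, voteSign (sensorResponse r (Θ i ω) (Y i ω) x) =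
      2 * A.indicator (1 : Ω → ℝ) ω - B.indicator (1 : Ω → ℝ) ω := fun ω =>
    voteSign_sensorResponse r (Θ i ω) (Y i ω) x
  have hAi : Integrable (A.indicator (1 : Ω → ℝ)) μ := (integrable_const 1).indicator hAm
  have hBi : Integrable (B.indicator (1 : Ω → ℝ)) μ := (integrable_const 1).indicator hBm
  simp only [heq]
  rw [integral_sub (hAi.const_mul 2) hBi, integral_const_mul, integral_indicator_one hAm,
    integral_indicator_one hBm, h.measureReal_center_mem i x,
    h.measureReal_center_mem_label_one i hx hae]
  ring

theorem variance_sum_voteSign_le (h : IsSpecialistModel μ P r Θ X Y Xq Yq) (x : Cube d) :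
    Var[fun ω => ∑ i, voteSign (sensorResponse r (Θ i ω) (Y i ω) x); μ] ≤
      n * (cubeUniform d).real (Metric.closedBall x r) := by
  have hproj : Measurable fun p : Cube d × Cube d × Fin 2 => (p.1, p.2.2) := by fun_prop
  have hvote := Measurable.comp (measurable_voteSign_sensorResponse r x) hproj
  have hind : iIndepFun (fun i ω => voteSign (sensorResponse r (Θ i ω) (Y i ω) x)) μ :=
    h.indep_sensors.comp (fun _ p => voteSign (sensorResponse r p.1 p.2.2 x)) fun _ => hvote
  have hsum := IndepFun.variance_sum (s := Finset.univ) (fun i _ => h.memLp_voteSign i x)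
    fun i _ j _ hij => hind.indepFun hij
  have hfun : (∑ i, fun ω => voteSign (sensorResponse r (Θ i ω) (Y i ω) x)) =
      fun ω => ∑ i, voteSign (sensorResponse r (Θ i ω) (Y i ω) x) := by
    ext ω; simp
  rw [hfun] at hsum
  rw [hsum]
  calc _ ≤ ∑ _i : Fin n, (cubeUniform d).real (Metric.closedBall x r) :=
        Finset.sum_le_sum fun i _ => h.variance_voteSign_le i x
    _ = _ := by simp

/-- Chebyshev bounds on the probability that the network decides against the local mean label. -/
theorem margin_mul_measureReal_le [IsProbabilityMeasure P]
    (h : IsSpecialistModel μ P r Θ X Y Xq Yq) (hn : 0 < n) {x : Cube d} (hx : cubeUniform d (Metric.closedBall x r) ≠ 0)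
    (hae : ∀ᵐ θ ∂(cubeUniform d).restrict (Metric.closedBall x r),
      P.fst (Metric.closedBall θ r) ≠ 0) :
    (2 * twoStepAverage (cubeUniform d) P.fst r (labelPosterior P) x - 1) *
        μ.real {ω | networkRule r (fun i => Θ i ω) (fun i => Y i ω) x ≠ 1} ≤
      1 / √(n * (cubeUniform d).real (Metric.closedBall x r)) ∧
    (1 - 2 * twoStepAverage (cubeUniform d) P.fst r (labelPosterior P) x) *
        μ.real {ω | networkRule r (fun i => Θ i ω) (fun i => Y i ω) x = 1} ≤
      1 / √(n * (cubeUniform d).real (Metric.closedBall x r)) := by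
  set q := (cubeUniform d).real (Metric.closedBall x r) with hq
  set t := 2 * twoStepAverage (cubeUniform d) P.fst r (labelPosterior P) x - 1 with ht
  have hq0 : 0 < q := ENNReal.toReal_pos hx (measure_ne_top _ _)
  have hN : 0 < n * q := mul_pos (by exact_mod_cast hn) hq0
  set S : Ω → ℝ := fun ω => ∑ i, voteSign (sensorResponse r (Θ i ω) (Y i ω) x) with hS
  have hSL : MemLp S 2 μ := memLp_finsetSum _ fun i _ => h.memLp_voteSign i x
  have hmean : ∫ ω, S ω ∂μ = n * q * t := by
    rw [hS, integral_finsetSum _ fun i _ => (h.memLp_voteSign i x).integrable one_le_two]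
    simp only [h.integral_voteSign _ hx hae]
    simp [mul_assoc, hq, ht]
  have hvar := h.variance_sum_voteSign_le x
  have ht' : 1 - 2 * twoStepAverage (cubeUniform d) P.fst r (labelPosterior P) x = -t := by
    rw [ht]; ring
  rw [ht']
  have hquo : 0 ≤ 1 / √(n * q) := by positivity
  -- Enlarging the event is harmless: for a negative coefficient `a` the left side is nonpositive
  -- anyway.
  have key : ∀ {a p p' : ℝ}, 0 ≤ p → p ≤ p' → a * p' ≤ 1 / √(n * q) → a * p ≤ 1 / √(n * q) := by
    intro a p p' h0 h1 h2
    rcases le_total a 0 with ha | ha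
    · exact (mul_nonpos_of_nonpos_of_nonneg ha h0).trans hquo
    · exact (mul_le_mul_of_nonneg_left h1 ha).trans h2
  constructor
  · refine key measureReal_nonneg (measureReal_mono fun ω hω => ?_)
      (mul_measureReal_nonpos_le hSL hN hmean hvar)
    exact sum_voteSign_nonpos hω
  · refine key measureReal_nonneg (measureReal_mono fun ω hω => ?_)
      (mul_measureReal_nonpos_le (S := fun ω => -S ω) hSL.neg hN (t := -t) ?_ ?_)
    · exact neg_nonpos.2 (sum_voteSign_nonneg hω)
    · rw [integral_neg, hmean]; ring
    · rw [show (fun ω => -S ω) = -S from rfl, variance_neg]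
      exact hvar

end IsSpecialistModel

/-! ### The Bayes error as an integral -/

section Bayes

variable {d : ℕ} (P : Measure (Cube d × Fin 2)) [IsProbabilityMeasure P]

theorem measureReal_condKernel_zero (x : Cube d) :
    (P.condKernel x).real {0} = 1 - labelPosterior P x := by
  have h : ({0} : Set (Fin 2)) = {1}ᶜ := by
    ext y; fin_cases y <;> simp
  rw [h, probReal_compl_eq_one_sub (measurableSet_singleton 1)]
  rfl

theorem integral_eq_integral_labelPosterior {F : Cube d × Fin 2 → ℝ} (hF : Measurable F)
    (hF1 : ∀ p, ‖F p‖ ≤ 1) :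
    ∫ p, F p ∂P =
      ∫ x, ((1 - labelPosterior P x) * F (x, 0) + labelPosterior P x * F (x, 1)) ∂P.fst := by
  have hint : Integrable F (P.fst ⊗ₘ P.condKernel) :=
    Integrable.of_bound hF.aestronglyMeasurable 1 (ae_of_all _ hF1)
  conv_lhs => rw [← P.disintegrate P.condKernel]
  rw [Measure.integral_compProd hint]
  refine integral_congr_ae (ae_of_all _ fun x => ?_)
  beta_reduce
  rw [integral_fintype .of_finite, Fin.sum_univ_two, measureReal_condKernel_zero]
  rfl

/-- The conditional error probability of the best decision at an observation. -/
noncomputable def bayesPointwiseError (x : Cube d) : ℝ :=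
  min (labelPosterior P x) (1 - labelPosterior P x)

theorem measurable_bayesPointwiseError : Measurable (bayesPointwiseError P) :=
  (measurable_labelPosterior P).min (measurable_const.sub (measurable_labelPosterior P))

theorem norm_bayesPointwiseError_le_one (x : Cube d) : ‖bayesPointwiseError P x‖ ≤ 1 := by
  have h0 := labelPosterior_nonneg P x
  have h1 := labelPosterior_le_one P x
  rw [bayesPointwiseError, Real.norm_of_nonneg (le_min h0 (by linarith))]
  exact (min_le_left _ _).trans h1

theorem integrable_bayesPointwiseError : Integrable (bayesPointwiseError P) P.fst :=
  Integrable.of_bound (measurable_bayesPointwiseError P).aestronglyMeasurable 1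
    (ae_of_all _ (norm_bayesPointwiseError_le_one P))

theorem measureReal_error_eq {g : Cube d → Fin 2} (hg : Measurable g) :
    P.real {p | g p.1 ≠ p.2} =
      ∫ x, (if g x = 1 then 1 - labelPosterior P x else labelPosterior P x) ∂P.fst := by
  have hE : MeasurableSet {p : Cube d × Fin 2 | g p.1 ≠ p.2} :=
    (measurableSet_eq_fun (hg.comp measurable_fst) measurable_snd).compl
  rw [← integral_indicator_one hE, integral_eq_integral_labelPosterior P
    (measurable_one.indicator hE)]
  · refine integral_congr_ae (ae_of_all _ fun x => ?_)
    rcases Fin.exists_fin_two.1 ⟨g x, rfl⟩ with h | h <;> simp [h]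
  · intro p
    by_cases hp : p ∈ {p : Cube d × Fin 2 | g p.1 ≠ p.2}
    · rw [Set.indicator_of_mem hp]; simp
    · rw [Set.indicator_of_notMem hp]; simp

/-- Thresholding the posterior at `1 / 2` attains the pointwise minimum, below which no classifier
can go. -/
theorem bayesError_eq_integral : bayesError P = ∫ x, bayesPointwiseError P x ∂P.fst := by
  have hη := measurable_labelPosterior P
  refine le_antisymm ?_ ?_
  · have hs : MeasurableSet {x | 1 / 2 ≤ labelPosterior P x} := measurableSet_le measurable_const hη
    have hg : Measurable fun x => if 1 / 2 ≤ labelPosterior P x then (1 : Fin 2) else 0 :=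
      Measurable.ite hs measurable_const measurable_const
    refine (ciInf_le ⟨0, ?_⟩ ⟨_, hg⟩).trans (le_of_eq ?_)
    · rintro _ ⟨g, rfl⟩
      exact measureReal_nonneg
    · refine (measureReal_error_eq P hg).trans (integral_congr_ae (ae_of_all _ fun x => ?_))
      simp only [bayesPointwiseError]
      by_cases h : 1 / 2 ≤ labelPosterior P x
      · simp only [h, if_true]
        rw [min_eq_right (by linarith)]
      · simp only [h, if_false, zero_ne_one]
        rw [min_eq_left (by linarith)]
  · have : Nonempty {g : Cube d → Fin 2 // Measurable g} := ⟨⟨_, measurable_const (a := 0)⟩⟩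
    refine le_ciInf fun g => ?_
    rw [measureReal_error_eq P g.2]
    refine integral_mono (integrable_bayesPointwiseError P) ?_ fun x => ?_
    · refine Integrable.of_bound (Measurable.ite (g.2 (measurableSet_singleton 1))
        (measurable_const.sub hη) hη).aestronglyMeasurable 1 (ae_of_all _ fun x => ?_)
      have h0 := labelPosterior_nonneg P x
      have h1 := labelPosterior_le_one P x
      rw [Real.norm_eq_abs, abs_le]
      split_ifs <;> constructor <;> linarith
    · simp only [bayesPointwiseError]
      split_ifs
      · exact min_le_right _ _
      · exact min_le_left _ _

end Bayes

/-! ### The excess error at one query -/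

theorem mixture_sub_min_nonneg {e a : ℝ} (ha0 : 0 ≤ a) (ha1 : a ≤ 1) :
    0 ≤ (1 - e) * a + e * (1 - a) - min e (1 - e) := by
  have h1 := min_le_left e (1 - e)
  have h2 := min_le_right e (1 - e)
  nlinarith

/-- Here `e` is the posterior, `m` its local average and `a` the probability of deciding `1`. The
left side is `(1 - 2 * e) * a` or `(2 * e - 1) * (1 - a)`; exchanging `e` for `m` there costs at
most `2 * |e - m|`. -/
theorem mixture_sub_min_le {e m a b : ℝ} (ha0 : 0 ≤ a) (ha1 : a ≤ 1)
    (h1 : (2 * m - 1) * (1 - a) ≤ b) (h2 : (1 - 2 * m) * a ≤ b) :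
    (1 - e) * a + e * (1 - a) - min e (1 - e) ≤ b + 2 * |e - m| := by
  have h3 := le_abs_self (e - m)
  have h4 := neg_abs_le (e - m)
  have h5 := abs_nonneg (e - m)
  rcases min_cases e (1 - e) with ⟨h, h'⟩ | ⟨h, h'⟩ <;> rw [h]
  · have : (1 - e) * a + e * (1 - a) - e = (1 - 2 * m) * a + 2 * (m - e) * a := by ring
    rw [this]
    nlinarith
  · have : (1 - e) * a + e * (1 - a) - (1 - e) = (2 * m - 1) * (1 - a) + 2 * (e - m) * (1 - a) := by
      ring
    rw [this]
    nlinarith [mul_nonneg (sub_nonneg.2 ha1) (sub_nonneg.2 h3)]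

/-! ### Joint measurability of the network rule in sample and query -/

theorem voteValue_sensorResponse {d : ℕ} (r : ℝ) (θ : Cube d) (y : Fin 2) (x : Cube d) :
    voteValue (sensorResponse r θ y x) =
      if dist x θ ≤ r then ((y : ℕ) : ℝ) else 0 := by
  classical
  simp only [sensorResponse, Metric.mem_closedBall]
  split_ifs <;> rfl

theorem isSome_sensorResponse {d : ℕ} (r : ℝ) (θ : Cube d) (y : Fin 2) (x : Cube d) :
    (sensorResponse r θ y x).isSome ↔ dist x θ ≤ r := by
  classical
  simp only [sensorResponse, Metric.mem_closedBall]
  split_ifs with h <;> simp [h]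

theorem measurable_networkRule {d n : ℕ} (r : ℝ) :
    Measurable fun p : (Fin n → Cube d × Cube d × Fin 2) × Cube d =>
      networkRule r (fun i => (p.1 i).1) (fun i => (p.1 i).2.2) p.2 := by
  have hs : ∀ i, MeasurableSet {p : (Fin n → Cube d × Cube d × Fin 2) × Cube d |
      dist p.2 (p.1 i).1 ≤ r} := fun i => by
    refine measurableSet_le (Measurable.dist measurable_snd ?_) measurable_const
    fun_prop
  have hy : ∀ i, Measurable fun p : (Fin n → Cube d × Cube d × Fin 2) × Cube d =>
      (((p.1 i).2.2 : ℕ) : ℝ) := fun i => by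
    have : Measurable fun y : Fin 2 => ((y : ℕ) : ℝ) := measurable_of_finite _
    exact this.comp (by fun_prop)
  simp only [networkRule, majorityVote, voteValue_sensorResponse, isSome_sensorResponse]
  refine Measurable.ite (measurableSet_le measurable_const (Measurable.div ?_ ?_))
    measurable_const measurable_const
  · exact Finset.measurable_fun_sum _ fun i _ => Measurable.ite (hs i) (hy i) measurable_const
  · exact Finset.measurable_fun_sum _ fun i _ =>
      Measurable.ite (hs i) measurable_const measurable_const

/-- The probability that the network decides `1` at a fixed query. -/
noncomputable def decideOneProb {d n : ℕ} {Ω : Type*} [MeasurableSpace Ω] (μ : Measure Ω)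
    (r : ℝ) (Θ : Fin n → Ω → Cube d) (Y : Fin n → Ω → Fin 2) (x : Cube d) : ℝ :=
  μ.real {ω | networkRule r (fun i => Θ i ω) (fun i => Y i ω) x = 1}

/-! ### The expected error of the network -/

namespace IsSpecialistModel

variable {d n : ℕ} {Ω : Type*} [MeasurableSpace Ω] {μ : Measure Ω}
  {P : Measure (Cube d × Fin 2)} {r : ℝ} {Θ X : Fin n → Ω → Cube d}
  {Y : Fin n → Ω → Fin 2} {Xq : Ω → Cube d} {Yq : Ω → Fin 2}

theorem measurable_sensors (h : IsSpecialistModel μ P r Θ X Y Xq Yq) :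
    Measurable fun ω (i : Fin n) => (Θ i ω, X i ω, Y i ω) :=
  measurable_pi_lambda _ fun i =>
    (h.measurable_center i).prodMk ((h.measurable_obs i).prodMk (h.measurable_label i))

theorem measurable_networkRule_comp (h : IsSpecialistModel μ P r Θ X Y Xq Yq)
    {Z : Ω → Cube d} (hZ : Measurable Z) :
    Measurable fun ω => networkRule r (fun i => Θ i ω) (fun i => Y i ω) (Z ω) := by
  have hcomp := Measurable.comp (measurable_networkRule r) (h.measurable_sensors.prodMk hZ)
  exact hcomp

variable [IsProbabilityMeasure μ]

theorem integral_conditionalError_eq_measureReal (h : IsSpecialistModel μ P r Θ X Y Xq Yq) :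
    ∫ ω, conditionalError μ r Θ X Y Xq Yq ω ∂μ =
      μ.real {ω | networkRule r (fun i => Θ i ω) (fun i => Y i ω) (Xq ω) ≠ Yq ω} := by
  have hE : MeasurableSet
      {ω | networkRule r (fun i => Θ i ω) (fun i => Y i ω) (Xq ω) ≠ Yq ω} :=
    (measurableSet_eq_fun (h.measurable_networkRule_comp h.measurable_queryObs)
      h.measurable_queryLabel).compl
  rw [conditionalError, integral_condExp h.measurable_sensors.comap_le]
  exact integral_indicator_one hE

theorem measureReal_networkRule_ne_one (h : IsSpecialistModel μ P r Θ X Y Xq Yq) (x : Cube d) :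
    μ.real {ω | networkRule r (fun i => Θ i ω) (fun i => Y i ω) x ≠ 1} =
      1 - decideOneProb μ r Θ Y x :=
  probReal_compl_eq_one_sub
    (h.measurable_networkRule_comp (measurable_const (a := x)) (measurableSet_singleton 1))

/-- The tower property removes the conditioning. Independence makes the joint law of sensors and
query a product, so the query can be frozen and then integrated against `P`. -/
theorem integral_conditionalError [IsProbabilityMeasure P]
    (h : IsSpecialistModel μ P r Θ X Y Xq Yq) :
    Measurable (decideOneProb μ r Θ Y) ∧ ∫ ω, conditionalError μ r Θ X Y Xq Yq ω ∂μ =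
      ∫ x, ((1 - labelPosterior P x) * decideOneProb μ r Θ Y x +
        labelPosterior P x * (1 - decideOneProb μ r Θ Y x)) ∂P.fst := by
  set T : Ω → Fin n → Cube d × Cube d × Fin 2 := fun ω i => (Θ i ω, X i ω, Y i ω) with hT
  have hTm : Measurable T := h.measurable_sensors
  have hQm : Measurable fun ω => (Xq ω, Yq ω) :=
    h.measurable_queryObs.prodMk h.measurable_queryLabel
  set E : Set ((Fin n → Cube d × Cube d × Fin 2) × (Cube d × Fin 2)) :=
    {p | networkRule r (fun i => (p.1 i).1) (fun i => (p.1 i).2.2) p.2.1 ≠ p.2.2} with hE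
  have hproj : Measurable fun p : (Fin n → Cube d × Cube d × Fin 2) × (Cube d × Fin 2) =>
      (p.1, p.2.1) := by fun_prop
  have hEm : MeasurableSet E :=
    (measurableSet_eq_fun ((measurable_networkRule r).comp hproj)
      (measurable_snd.comp measurable_snd)).compl
  set F : Cube d × Fin 2 → ℝ := fun p =>
    μ.real {ω | networkRule r (fun i => Θ i ω) (fun i => Y i ω) p.1 ≠ p.2} with hF
  have hsec : ∀ p, μ.map T ((fun t => (t, p)) ⁻¹' E) =
      μ {ω | networkRule r (fun i => Θ i ω) (fun i => Y i ω) p.1 ≠ p.2} := fun p =>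
    Measure.map_apply hTm (measurable_prodMk_right hEm)
  have hFm' : Measurable fun p : Cube d × Fin 2 =>
      μ {ω | networkRule r (fun i => Θ i ω) (fun i => Y i ω) p.1 ≠ p.2} := by
    simp only [← hsec]
    have : IsProbabilityMeasure (μ.map T) := Measure.isProbabilityMeasure_map hTm.aemeasurable
    exact measurable_measure_prodMk_right hEm
  have hFm : Measurable F := hFm'.ennreal_toReal
  have hF1 : ∀ p, ‖F p‖ ≤ 1 := fun p => by
    rw [Real.norm_of_nonneg measureReal_nonneg]; exact measureReal_le_one
  have hFone : ∀ x, F (x, 1) = 1 - decideOneProb μ r Θ Y x := h.measureReal_networkRule_ne_one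
  have hFzero : ∀ x, F (x, 0) = decideOneProb μ r Θ Y x := fun x => by
    have : ∀ y : Fin 2, y ≠ 0 ↔ y = 1 := by decide
    simp only [hF, this]
    rfl
  have hae := (indepFun_iff_map_prod_eq_prod_map_map hTm.aemeasurable hQm.aemeasurable).1
    h.indep_query
  refine ⟨?_, ?_⟩
  · have : decideOneProb μ r Θ Y = fun x => F (x, 0) := funext fun x => (hFzero x).symm
    rw [this]
    exact hFm.comp measurable_prodMk_right
  have hprob : μ {ω | networkRule r (fun i => Θ i ω) (fun i => Y i ω) (Xq ω) ≠ Yq ω} =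
      ∫⁻ p, μ {ω | networkRule r (fun i => Θ i ω) (fun i => Y i ω) p.1 ≠ p.2} ∂P := by
    have : IsProbabilityMeasure (μ.map T) := Measure.isProbabilityMeasure_map hTm.aemeasurable
    have h1 : μ {ω | networkRule r (fun i => Θ i ω) (fun i => Y i ω) (Xq ω) ≠ Yq ω} =
        μ.map (fun ω => (T ω, (Xq ω, Yq ω))) E :=
      (Measure.map_apply (hTm.prodMk hQm) hEm).symm
    rw [h1, hae, h.query_law, Measure.prod_apply_symm hEm]
    simp only [hsec]
  rw [h.integral_conditionalError_eq_measureReal, measureReal_def, hprob,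
    ← integral_toReal hFm'.aemeasurable (ae_of_all _ fun p => measure_lt_top _ _)]
  refine (integral_eq_integral_labelPosterior P hFm hF1).trans ?_
  simp only [hFone, hFzero]

theorem bayesError_le_and_le [IsProbabilityMeasure P]
    (h : IsSpecialistModel μ P r Θ X Y Xq Yq) (hn : 0 < n) {c : ℝ}
    (hc : 0 < c) (hball : ∀ x, c ≤ (cubeUniform d).real (Metric.closedBall x r)) :
    bayesError P ≤ ∫ ω, conditionalError μ r Θ X Y Xq Yq ω ∂μ ∧
    ENNReal.ofReal (∫ ω, conditionalError μ r Θ X Y Xq Yq ω ∂μ - bayesError P) ≤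
      ENNReal.ofReal (1 / √(n * c)) + 2 * ∫⁻ x, ‖labelPosterior P x -
        twoStepAverage (cubeUniform d) P.fst r (labelPosterior P) x‖ₑ ∂P.fst := by
  obtain ⟨ham, herr⟩ := h.integral_conditionalError
  set a := decideOneProb μ r Θ Y with ha
  have ha0 : ∀ x, 0 ≤ a x := fun x => measureReal_nonneg
  have ha1 : ∀ x, a x ≤ 1 := fun x => measureReal_le_one
  have hη := measurable_labelPosterior P
  set R : Cube d → ℝ := fun x =>
    (1 - labelPosterior P x) * a x + labelPosterior P x * (1 - a x) with hR
  have hRm : Measurable R :=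
    ((measurable_const.sub hη).mul ham).add (hη.mul (measurable_const.sub ham))
  have hRi : Integrable R P.fst := by
    refine Integrable.of_bound hRm.aestronglyMeasurable 1 (ae_of_all _ fun x => ?_)
    have h0 := labelPosterior_nonneg P x
    have h1 := labelPosterior_le_one P x
    have h2 := ha0 x
    have h3 := ha1 x
    rw [Real.norm_eq_abs, abs_le]
    constructor <;> simp only [hR] <;> nlinarith
  have hdiff : ∫ ω, conditionalError μ r Θ X Y Xq Yq ω ∂μ - bayesError P =
      ∫ x, (R x - bayesPointwiseError P x) ∂P.fst := by
    rw [herr, bayesError_eq_integral, integral_sub hRi (integrable_bayesPointwiseError P)]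
  have hnn : ∀ x, 0 ≤ R x - bayesPointwiseError P x := fun x =>
    mixture_sub_min_nonneg (ha0 x) (ha1 x)
  refine ⟨?_, ?_⟩
  · rw [← sub_nonneg, hdiff]
    exact integral_nonneg hnn
  have hdi : Integrable (fun x => R x - bayesPointwiseError P x) P.fst :=
    hRi.sub (integrable_bayesPointwiseError P)
  rw [hdiff, ofReal_integral_eq_lintegral_ofReal hdi (ae_of_all _ hnn)]
  calc _ ≤ ∫⁻ x, (ENNReal.ofReal (1 / √(n * c)) + 2 * ‖labelPosterior P x -
        twoStepAverage (cubeUniform d) P.fst r (labelPosterior P) x‖ₑ) ∂P.fst := by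
        refine lintegral_mono_ae ?_
        -- The pointwise bound needs almost every center near `x` to have a ball of positive mass,
        -- which holds for almost every `x`.
        filter_upwards [ae_ae_measure_closedBall_ne_zero (cubeUniform d) P.fst r] with x hx
        have hq : cubeUniform d (Metric.closedBall x r) ≠ 0 := fun h0 => by
          have := hball x
          rw [measureReal_def, h0, ENNReal.toReal_zero] at this
          linarith
        obtain ⟨h1, h2⟩ := h.margin_mul_measureReal_le hn hq hx
        rw [h.measureReal_networkRule_ne_one] at h1
        have hsqrt : 1 / √(n * (cubeUniform d).real (Metric.closedBall x r)) ≤ 1 / √(n * c) := by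
          have : (0 : ℝ) < n := by exact_mod_cast hn
          gcongr
          exact hball x
        refine (ENNReal.ofReal_le_ofReal (mixture_sub_min_le (ha0 x) (ha1 x)
          (h1.trans hsqrt) (h2.trans hsqrt))).trans ?_
        rw [ENNReal.ofReal_add (by positivity) (by positivity),
          ENNReal.ofReal_mul zero_le_two, ← Real.enorm_eq_ofReal_abs]
        simp
    _ = _ := by
        rw [lintegral_add_left measurable_const, lintegral_const_mul' _ _ (by simp)]
        simp

end IsSpecialistModel

/-! ### Convergence to the Bayes error -/

theorem proposition4 (d : ℕ) (r : ℕ → ℝ) (hr : ∀ n, 0 ≤ r n)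
    (hr_zero : Tendsto r atTop (𝓝 0))
    (hr_rate : Tendsto (fun n : ℕ => (r n) ^ d * (n : ℝ)) atTop atTop)
    (P : Measure (Cube d × Fin 2)) [IsProbabilityMeasure P]
    (Ω : ℕ → Type*) [∀ n, MeasurableSpace (Ω n)]
    (μ : ∀ n, Measure (Ω n)) [∀ n, IsProbabilityMeasure (μ n)]
    (Θ X : ∀ n, Fin n → Ω n → Cube d) (Y : ∀ n, Fin n → Ω n → Fin 2)
    (Xq : ∀ n, Ω n → Cube d) (Yq : ∀ n, Ω n → Fin 2)
    (hmodel : ∀ n, IsSpecialistModel (μ n) P (r n) (Θ n) (X n) (Y n) (Xq n) (Yq n)) :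
    Tendsto (fun n => ∫ ω, conditionalError (μ n) (r n) (Θ n) (X n) (Y n) (Xq n) (Yq n) ω ∂(μ n))
      atTop (𝓝 (bayesError P)) := by
  set c : ℕ → ℝ := fun n => (r n / (d + 1)) ^ d with hc
  have hd : (0 : ℝ) < d + 1 := by positivity
  have hgood : ∀ᶠ n in atTop, 0 < n ∧ 0 < c n ∧ r n ≤ 1 / 2 := by
    filter_upwards [hr_rate.eventually_gt_atTop 0, eventually_gt_atTop 0,
      hr_zero.eventually_le_const (by norm_num : (0 : ℝ) < 1 / 2)] with n h1 h2 h3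
    refine ⟨h2, ?_, h3⟩
    simp only [hc]
    rw [div_pow]
    exact div_pos (pos_of_mul_pos_left h1 n.cast_nonneg) (by positivity)
  -- The constant `(2 * (d + 1)) ^ d` is the ratio of the upper bound `(2 * r) ^ d` to the lower
  -- bound `(r / (d + 1)) ^ d` for the mass of a ball.
  have happrox := tendsto_lintegral_enorm_sub_twoStepAverage (lam := cubeUniform d) (rho := P.fst)
    hr_zero (C := ENNReal.ofReal ((2 * (d + 1)) ^ d)) ENNReal.ofReal_ne_top
    (by
      filter_upwards [hgood] with n ⟨_, hcn, hrn⟩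
      refine ⟨ENNReal.ofReal (c n), by simpa using hcn, ENNReal.ofReal_ne_top,
        fun x => le_cubeUniform_closedBall x (hr n) hrn, fun x => ?_⟩
      refine (cubeUniform_closedBall_le x (hr n)).trans (le_of_eq ?_)
      rw [← ENNReal.ofReal_mul (by positivity), ← mul_pow]
      congr 2
      field_simp)
    (measurable_labelPosterior P) (labelPosterior_nonneg P) (labelPosterior_le_one P)
  have hN : Tendsto (fun n : ℕ => (n : ℝ) * c n) atTop atTop := by
    refine (hr_rate.atTop_div_const (pow_pos hd d)).congr fun n => ?_
    simp only [hc, div_pow]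
    ring
  have hsqrt : Tendsto (fun n : ℕ => 1 / √((n : ℝ) * c n)) atTop (𝓝 0) :=
    tendsto_const_nhds.div_atTop (Real.tendsto_sqrt_atTop.comp hN)
  have hbound : Tendsto (fun n : ℕ => ENNReal.ofReal (1 / √((n : ℝ) * c n)) +
      2 * ∫⁻ x, ‖labelPosterior P x -
        twoStepAverage (cubeUniform d) P.fst (r n) (labelPosterior P) x‖ₑ ∂P.fst) atTop
      (𝓝 0) := by
    have h1 := ENNReal.tendsto_ofReal hsqrt
    have h2 := ENNReal.Tendsto.const_mul (a := 2) happrox (Or.inr (by simp))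
    simpa using h1.add h2
  have hboth : ∀ᶠ n in atTop,
      bayesError P ≤
        ∫ ω, conditionalError (μ n) (r n) (Θ n) (X n) (Y n) (Xq n) (Yq n) ω ∂(μ n) ∧
      ENNReal.ofReal (∫ ω, conditionalError (μ n) (r n) (Θ n) (X n) (Y n) (Xq n) (Yq n) ω ∂(μ n) -
        bayesError P) ≤ ENNReal.ofReal (1 / √((n : ℝ) * c n)) + 2 * ∫⁻ x, ‖labelPosterior P x -
        twoStepAverage (cubeUniform d) P.fst (r n) (labelPosterior P) x‖ₑ ∂P.fst := by
    filter_upwards [hgood] with n ⟨hn, hcn, hrn⟩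
    refine (hmodel n).bayesError_le_and_le hn hcn fun x => ?_
    rw [measureReal_def, ← ENNReal.ofReal_le_iff_le_toReal (measure_ne_top _ _)]
    exact le_cubeUniform_closedBall x (hr n) hrn
  -- The excess was bounded in `ℝ≥0∞`; since it is nonnegative, passing through `ENNReal.ofReal` and
  -- back loses nothing.
  have hexcess := (ENNReal.tendsto_toReal ENNReal.zero_ne_top).comp
    (tendsto_of_tendsto_of_tendsto_of_le_of_le' tendsto_const_nhds hbound
      (Eventually.of_forall fun _ => zero_le) (hboth.mono fun _ h => h.2))
  rw [← tendsto_sub_nhds_zero_iff]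
  refine hexcess.congr' ?_
  filter_upwards [hboth] with n hn
  exact ENNReal.toReal_ofReal (sub_nonneg.2 hn.1)
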